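/- Let $\Omega=(0,1)\times(0,1)\subset\mathbb R^2$ and let $h:[0,1]\to\mathbb R$ be a bounded function with $h(0)=0$, $h>0$ on $(0,1]$ and $h\in C^1(0,1]$. Let $0<\theta<1$ and suppose that there is a constant $C_0$ such that $$\int_{B(x,r)\cap\Omega}h(y_1)^{-1}\,dy\le C_0\,|B(x,r)\cap\Omega|^{\theta}\qquad\text{for all }x\in\Omega,\ 0<r\le \operatorname{diam}\Omega ,$$ where $B(x,r)$ is the Euclidean ball. Let $$\mathcal H^1_h(\Omega)=\{u\in L^2(\Omega):\ \partial_{x_1}u\in L^2(\Omega),\ \sqrt{h(x_1)}\,\partial_{x_2}u\in L^2(\Omega)\}$$ (weak derivatives), with the norm $$\|u\|_{\mathcal H^1_h(\Omega)}=\Big(\|u\|_{L^2(\Omega)}^2+\|\partial_{x_1}u\|_{L^2(\Omega)}^2+\|\sqrt{h(x_1)}\,\partial_{x_2}u\|_{L^2(\Omega)}^2\Big)^{1/2},$$ and let $\mathcal H^1_{h,0}(\Omega)$ be the closure of $C_0^\infty(\Omega)$ in $\mathcal H^1_h(\Omega)$, with the same norm. Then: 1. There is a constant $C>0$ such that for all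 real $q$ with $2\le q\le \frac{2}{1-\theta}$ and all $u\in\mathcal H^1_{h,0}(\Omega)$, $$\|u\|_{L^q(\Omega)}\le C\,\|u\|_{\mathcal H^1_h(\Omega)}.$$ 2. (Poincaré inequality) There is a constant $C>0$ such that for all $u\in\mathcal H^1_{h,0}(\Omega)$, $$\|u\|_{L^2(\Omega)}\le C\left(\int_\Omega |\partial_{x_1}u|^2+h(x_1)\,|\partial_{x_2}u|^2\,dx\right)^{1/2}.$$ -/

import Mathlib

open MeasureTheory TopologicalSpace Set
open scoped Distributions ENNReal

/-- The Euclidean plane; `x 0` and `x 1` are the coordinates `x₁` and `x₂`. -/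
abbrev Plane : Type := EuclideanSpace ℝ (Fin 2)

/-- The open unit square `Ω = (0,1) × (0,1)`. -/
def unitSquare : Opens Plane where
  carrier := {x | 0 < x 0 ∧ x 0 < 1 ∧ 0 < x 1 ∧ x 1 < 1}
  is_open' := by
    have h0 : Continuous fun x : Plane => x 0 := by fun_prop
    have h1 : Continuous fun x : Plane => x 1 := by fun_prop
    exact (isOpen_lt continuous_const h0).inter ((isOpen_lt h0 continuous_const).inter
      ((isOpen_lt continuous_const h1).inter (isOpen_lt h1 continuous_const)))

/-- The standing assumptions on the degenerate coefficient `h : [0,1] → ℝ` (the values of `h`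
outside `[0,1]` play no role): it is bounded, vanishes at `0`, is positive on `(0,1]` and is of
class `C¹` on `(0,1]`. -/
structure IsDegenerateCoefficient (h : ℝ → ℝ) : Prop where
  bounded : ∃ M : ℝ, ∀ t ∈ Icc (0 : ℝ) 1, |h t| ≤ M
  zero : h 0 = 0
  pos : ∀ t ∈ Ioc (0 : ℝ) 1, 0 < h t
  contDiffOn : ContDiffOn ℝ 1 h (Ioc 0 1)

/-- `∫_{B ∩ Ω} h(x₁)⁻¹ dx ≤ C |B ∩ Ω|^θ` for all balls `B = B(x, r)` with center `x ∈ Ω` and radius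
`0 < r ≤ diam Ω`. The left-hand side is a Lebesgue integral with values in `[0, ∞]`. -/
def InverseBallBound (h : ℝ → ℝ) (θ C : ℝ) : Prop :=
  ∀ x ∈ unitSquare, ∀ r : ℝ, 0 < r → r ≤ Metric.diam (unitSquare : Set Plane) →
    ∫⁻ y in Metric.ball x r ∩ unitSquare, ENNReal.ofReal (h (y 0))⁻¹ ≤
      ENNReal.ofReal (C * volume.real (Metric.ball x r ∩ (unitSquare : Set Plane)) ^ θ)

/-- `g` is the weak partial derivative of `u` in the direction `xᵢ` on `Ω` (both in `L¹_loc(Ω)`). -/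
def HasWeakPartial (i : Fin 2) (u g : Plane → ℝ) : Prop :=
  LocallyIntegrableOn u unitSquare ∧ LocallyIntegrableOn g unitSquare ∧
    ∀ φ : 𝓓(unitSquare, ℝ),
      ∫ x in unitSquare, u x * fderiv ℝ φ x (EuclideanSpace.single i 1) =
        -∫ x in unitSquare, g x * φ x

/-- Weak partial derivatives on `Ω` are unique almost everywhere. -/
theorem HasWeakPartial.ae_eq {i : Fin 2} {u g g' : Plane → ℝ}
    (hg : HasWeakPartial i u g) (hg' : HasWeakPartial i u g') :
    ∀ᵐ x ∂(volume : Measure Plane), x ∈ unitSquare → g x = g' x := by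
  have key : ∀ᵐ x ∂(volume : Measure Plane), x ∈ (unitSquare : Set Plane) → (g - g') x = 0 := by
    refine unitSquare.isOpen.ae_eq_zero_of_integral_contDiff_smul_eq_zero
      (hg.2.1.sub hg'.2.1) fun φ h1 h2 h3 => ?_
    let ψ : 𝓓(unitSquare, ℝ) := ⟨φ, h1, h2, h3⟩
    have int : ∀ f : Plane → ℝ, LocallyIntegrableOn f unitSquare →
        Integrable (fun x => f x * φ x) := fun f hf => by
      have hK : IntegrableOn f (tsupport φ) := hf.integrableOn_compact_subset h3 h2
      have := hK.mul_continuousOn h1.continuous.continuousOn h2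
      rwa [integrableOn_iff_integrable_of_support_subset] at this
      exact fun x hx => subset_tsupport φ (right_ne_zero_of_mul hx)
    have restr : ∀ f : Plane → ℝ,
        ∫ x in unitSquare, f x * φ x = ∫ x, f x * φ x := fun f =>
      setIntegral_eq_integral_of_forall_compl_eq_zero fun x hx => by
        rw [image_eq_zero_of_notMem_tsupport (fun h => hx (h3 h)), mul_zero]
    have e : ∫ x in unitSquare, g x * φ x = ∫ x in unitSquare, g' x * φ x :=
      neg_injective ((hg.2.2 ψ).symm.trans (hg'.2.2 ψ))
    rw [restr, restr] at e
    calc ∫ x, φ x • (g - g') x = ∫ x, (g x * φ x - g' x * φ x) := by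
          congr 1; ext x; simp only [smul_eq_mul, Pi.sub_apply]; ring
      _ = 0 := by rw [integral_sub (int g hg.2.1) (int g' hg'.2.1), e, sub_self]
  filter_upwards [key] with x hx hxm
  exact sub_eq_zero.mp (hx hxm)

open Classical in
/-- The weak partial derivative `∂_{xᵢ} u` on `Ω`, determined almost everywhere when it exists
(and `0` otherwise). -/
noncomputable def weakPartial (i : Fin 2) (u : Plane → ℝ) : Plane → ℝ :=
  if H : ∃ g, HasWeakPartial i u g then H.choose else 0

/-- `u ∈ ℋ¹_h(Ω)`: `u`, `∂_{x₁} u` and `√h(x₁) ∂_{x₂} u` belong to `L²(Ω)`. -/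
structure MemH1 (h : ℝ → ℝ) (u : Plane → ℝ) : Prop where
  memLp : MemLp u 2 (volume.restrict unitSquare)
  weak_fst : ∃ g, HasWeakPartial 0 u g
  weak_snd : ∃ g, HasWeakPartial 1 u g
  memLp_fst : MemLp (weakPartial 0 u) 2 (volume.restrict unitSquare)
  memLp_snd : MemLp (fun x => √(h (x 0)) * weakPartial 1 u x) 2 (volume.restrict unitSquare)

/-- `(∫_Ω |∂_{x₁} u|² + h(x₁) |∂_{x₂} u|² dx)^{1/2}`. -/
noncomputable def energySeminorm (h : ℝ → ℝ) (u : Plane → ℝ) : ℝ :=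
  √(∫ x in unitSquare, (weakPartial 0 u x ^ 2 + h (x 0) * weakPartial 1 u x ^ 2))

/-- The norm of `ℋ¹_h(Ω)`. -/
noncomputable def normH1 (h : ℝ → ℝ) (u : Plane → ℝ) : ℝ :=
  √((∫ x in unitSquare, u x ^ 2) + (∫ x in unitSquare, weakPartial 0 u x ^ 2) +
    ∫ x in unitSquare, (√(h (x 0)) * weakPartial 1 u x) ^ 2)

/-- `u ∈ ℋ¹_{h,0}(Ω)`: `u` lies in the closure of `C₀^∞(Ω)` in `ℋ¹_h(Ω)`. -/
def MemH10 (h : ℝ → ℝ) (u : Plane → ℝ) : Prop :=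
  MemH1 h u ∧ ∀ ε > 0, ∃ φ : 𝓓(unitSquare, ℝ), normH1 h (u - ⇑φ) < ε

/-! Testing the ball condition on discs centred at `(y, 1/2)` turns it into a one-dimensional growth
condition for the measure `w dx₁`, `w = 1/h` on `(0,1)`: intervals of radius `δ` have mass at most
`K δ^α`, with `α = max (2θ - 1) 0`. It then suffices to bound the norm in `L^q`, `q = 4/(1 - α) ≥
2/(1 - θ)`, by the energy: `Ω` has measure one, so smaller exponents follow with the same constant,
and `q = 2` is the Poincaré inequality.

For a test function `f`, let `N = ∫ |f|^q` and let `E` be its energy. Gagliardo's inequality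
(`lintegral_rpow_le_mul_lintegral_fderiv`) bounds `N` by a product of `∫ |f|^(s-1) |∂₁f|` and `∫
|f|^(t-1) |∂₂f|` with `s + t = q`. Cauchy–Schwarz and Jensen control the first factor. The
degeneracy affects only the second, where Cauchy–Schwarz leaves the weighted integral `∫ w |f|^m`,
`m = 2(t - 1)`.

That integral is handled by a trace inequality on horizontal lines (`lintegral_rpow_le_of_growth`).
A function `g` of one variable with `∫ |g'|² = a` is Hölder continuous of order `1/2`, hence
comparable to `g(y)` at distances well below `g(y)²/a`. At this scale the growth condition lets `w
dx` be replaced by Lebesgue measure, at the price of a power of `g²/a`. The result is `∫ w |f|^m ≤ C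
E^(1-α) N^α`. Inserting it, `N` occurs on the right with exponent less than one and can be absorbed.
Density and Fatou's lemma extend the bound to the closure. -/

/-! ### One-dimensional inequalities -/

/-- A power `|g|^s`, `s > 1`, of a compactly supported `C¹` function on the line is bounded by
the total variation of `|g|^s`. -/
theorem enorm_rpow_le_lintegral_deriv {g : ℝ → ℝ} (hg : ContDiff ℝ 1 g)
    (hc : HasCompactSupport g) {s : ℝ} (hs : 1 < s) (x : ℝ) :
    ‖g x‖ₑ ^ s ≤ ENNReal.ofReal s * ∫⁻ y, ‖g y‖ₑ ^ (s - 1) * ‖deriv g y‖ₑ := by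
  have hs0 : 0 < s := by linarith
  have hG : ContDiff ℝ 1 (fun y => ‖g y‖ ^ s) := hg.norm_rpow hs
  have hGc : HasCompactSupport (fun y => ‖g y‖ ^ s) :=
    hc.comp_left (g := fun t : ℝ => ‖t‖ ^ s) (by simp [hs0.ne'])
  have h1 := hGc.enorm_le_lintegral_Ici_deriv hG x
  rw [Real.enorm_rpow_of_nonneg (norm_nonneg _) hs0.le, enorm_norm] at h1
  refine h1.trans ((setLIntegral_le_lintegral _ _).trans ?_)
  rw [← lintegral_const_mul' _ _ ENNReal.ofReal_ne_top]
  refine lintegral_mono fun y => ?_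
  have h2 := enorm_fderiv_norm_rpow_le (hg.differentiable one_ne_zero) (x := y)
    (p := s.toNNReal) (by simpa using hs)
  rw [Real.coe_toNNReal _ hs0.le] at h2
  have e1 : ‖deriv (fun y => ‖g y‖ ^ s) y‖ₑ = ‖fderiv ℝ (fun y => ‖g y‖ ^ s) y‖ₑ := by
    rw [← ofReal_norm, ← ofReal_norm, norm_deriv_eq_norm_fderiv]
  have e2 : ‖deriv g y‖ₑ = ‖fderiv ℝ g y‖ₑ := by
    rw [← ofReal_norm, ← ofReal_norm, norm_deriv_eq_norm_fderiv]
  rw [e1, e2, ← mul_assoc]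
  exact h2

/-- Cauchy–Schwarz: a `C¹` function on the line is Hölder continuous of order `1/2`. -/
theorem enorm_sub_sq_le_lintegral_deriv {g : ℝ → ℝ} (hg : ContDiff ℝ 1 g) (x y : ℝ) :
    ‖g x - g y‖ₑ ^ 2 ≤ ENNReal.ofReal |x - y| * ∫⁻ z, ‖deriv g z‖ₑ ^ 2 := by
  wlog hxy : y ≤ x generalizing x y
  · rw [enorm_sub_rev, abs_sub_comm]
    exact this y x (le_of_not_ge hxy)
  have hd : Continuous (deriv g) := hg.continuous_deriv le_rfl
  have h1 := enorm_sub_le_lintegral_deriv_of_contDiffOn_Icc hg.contDiffOn hxy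
  have h2 := ENNReal.lintegral_mul_norm_pow_le (μ := volume.restrict (Icc y x))
    (f := fun _ => 1) (g := fun z => ‖deriv g z‖ₑ ^ 2) (p := 1 / 2) (q := 1 / 2)
    (by fun_prop) (by fun_prop) (by norm_num) (by norm_num) (by norm_num)
  have h3 : ∀ w : ℝ≥0∞, (w ^ 2) ^ (1 / 2 : ℝ) = w := fun w => by
    rw [← ENNReal.rpow_natCast, ← ENNReal.rpow_mul]; norm_num
  have h4 : ∀ w : ℝ≥0∞, (w ^ (1 / 2 : ℝ)) ^ 2 = w := fun w => by
    rw [← ENNReal.rpow_natCast, ← ENNReal.rpow_mul]; norm_num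
  simp only [h3, ENNReal.one_rpow, one_mul, lintegral_one, Measure.restrict_apply_univ,
    Real.volume_Icc] at h2
  calc ‖g x - g y‖ₑ ^ 2 ≤ _ := pow_le_pow_left' (h1.trans h2) 2
    _ = ENNReal.ofReal (x - y) * ∫⁻ z in Icc y x, ‖deriv g z‖ₑ ^ 2 := by rw [mul_pow, h4, h4]
    _ ≤ _ := by
      rw [abs_of_nonneg (sub_nonneg.2 hxy)]
      gcongr
      exact Measure.restrict_le_self

/-- A one-dimensional trace inequality: if `g` is Hölder continuous of order `1/2`, vanishes outside
`(0,1)` and `μ` satisfies the growth condition `μ(B(y,δ)) ≤ K δ^α`, then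
`∫ |g|^(p+2(1-α)) dμ` is controlled by `∫ |g|^p dx`. -/
theorem lintegral_rpow_le_of_growth {g : ℝ → ℝ} (hg : Continuous g)
    (hsupp : ∀ x, g x ≠ 0 → x ∈ Ioo (0 : ℝ) 1) {a : ℝ} (ha : 0 < a)
    (hol : ∀ x y, (g x - g y) ^ 2 ≤ a * |x - y|) {μ : Measure ℝ} [SFinite μ] {K α p : ℝ}
    (hα : α < 1) (hp : 0 ≤ p)
    (hμ : ∀ y ∈ Ioo (0 : ℝ) 1, ∀ δ > 0, μ (Metric.ball y δ) ≤ ENNReal.ofReal (K * δ ^ α)) :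
    ∫⁻ x, ‖g x‖ₑ ^ (p + 2 * (1 - α)) ∂μ ≤
      ENNReal.ofReal (8 * 2 ^ (p + 2 * (1 - α)) * K) * ENNReal.ofReal a ^ (1 - α) *
        ∫⁻ y in Ioo (0 : ℝ) 1, ‖g y‖ₑ ^ p := by
  set m : ℝ := p + 2 * (1 - α) with hm
  have hm0 : 0 < m := by
    have : 0 < 1 - α := by linarith
    positivity
  have he : ∀ {x}, g x ≠ 0 → 0 < g x ^ 2 / a := fun h => by positivity
  have hen : ∀ x, ∀ {r : ℝ}, 0 ≤ r → ‖g x‖ₑ ^ r = ENNReal.ofReal (|g x| ^ r) := fun x r hr => by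
    rw [← ENNReal.ofReal_rpow_of_nonneg (abs_nonneg _) hr, ← Real.norm_eq_abs, ofReal_norm]
  -- `|g x|^m` is averaged over the ball of radius `g(x)²/(4a)`, where `|g x|` and `|g y|` agree up
  -- to a factor `2`. This permits replacing `x` by `y` both in the integrand (whence `8 * 2 ^ m`)
  -- and in the radius, so that after Fubini the `x`-section of `S` is a ball about `y`.
  let F : ℝ → ℝ≥0∞ := fun y => ENNReal.ofReal (8 * 2 ^ m * |g y| ^ m / (g y ^ 2 / a))
  let S : Set (ℝ × ℝ) := {z | |z.1 - z.2| < g z.2 ^ 2 / a}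
  have hS : MeasurableSet S := by
    refine (isOpen_lt ?_ ?_).measurableSet <;> fun_prop
  have hF : Measurable F := by fun_prop
  have key : ∀ x, ‖g x‖ₑ ^ m ≤ ∫⁻ y, S.indicator (fun z => F z.2) (x, y) := by
    intro x
    by_cases hx : g x = 0
    · simp [hx, hm0]
    have hex := he hx
    have hball : ∀ y ∈ Metric.ball x (g x ^ 2 / a / 4),
        ENNReal.ofReal (|g x| ^ m * (2 / (g x ^ 2 / a))) ≤ S.indicator (fun z => F z.2) (x, y) := by
      intro y hy
      rw [Metric.mem_ball, Real.dist_eq, abs_sub_comm] at hy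
      have h1 : (g x - g y) ^ 2 ≤ (g x / 2) ^ 2 := by
        refine (hol x y).trans ?_
        calc a * |x - y| ≤ a * (g x ^ 2 / a / 4) := by gcongr
          _ = _ := by field_simp; norm_num
      have h2 := sq_le_sq.1 h1
      rw [abs_div, abs_two] at h2
      have h3 : |g x| ≤ 2 * |g y| := by
        have := abs_sub_abs_le_abs_sub (g x) (g y); linarith
      have h4 : |g y| ≤ 2 * |g x| := by
        have := abs_sub_abs_le_abs_sub (g y) (g x)
        rw [abs_sub_comm] at this
        have := abs_nonneg (g x); linarith
      have hy0 : g y ≠ 0 := by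
        intro h; rw [h, abs_zero, mul_zero] at h3
        exact hx (abs_eq_zero.1 (le_antisymm h3 (abs_nonneg _)))
      have h5 : g x ^ 2 ≤ 4 * g y ^ 2 := by
        rw [← sq_abs (g x), ← sq_abs (g y)]; nlinarith [abs_nonneg (g x)]
      have h6 : g y ^ 2 ≤ 4 * g x ^ 2 := by
        rw [← sq_abs (g x), ← sq_abs (g y)]; nlinarith [abs_nonneg (g y)]
      have hxy : (x, y) ∈ S := by
        show |x - y| < g y ^ 2 / a
        refine hy.trans_le ?_
        rw [div_div, div_le_div_iff₀ (by positivity) ha]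
        nlinarith
      rw [indicator_of_mem hxy]
      refine ENNReal.ofReal_le_ofReal ?_
      calc |g x| ^ m * (2 / (g x ^ 2 / a)) ≤ (2 * |g y|) ^ m * (8 / (g y ^ 2 / a)) := by
            gcongr ?_ * ?_
            · exact Real.rpow_le_rpow (abs_nonneg _) h3 hm0.le
            · rw [div_le_div_iff₀ hex (he hy0), mul_div, mul_div]
              gcongr ?_ / _
              linarith
        _ = _ := by rw [Real.mul_rpow (by norm_num) (abs_nonneg _)]; ring
    calc ‖g x‖ₑ ^ m = ENNReal.ofReal (|g x| ^ m * (2 / (g x ^ 2 / a))) *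
          volume (Metric.ball x (g x ^ 2 / a / 4)) := by
          rw [hen x hm0.le, Real.volume_ball, ← ENNReal.ofReal_mul (by positivity)]
          congr 1; field_simp; norm_num
      _ = ∫⁻ y in Metric.ball x (g x ^ 2 / a / 4),
          ENNReal.ofReal (|g x| ^ m * (2 / (g x ^ 2 / a))) := by rw [setLIntegral_const]
      _ ≤ ∫⁻ y in Metric.ball x (g x ^ 2 / a / 4), S.indicator (fun z => F z.2) (x, y) :=
          setLIntegral_mono' Metric.isOpen_ball.measurableSet hball
      _ ≤ _ := setLIntegral_le_lintegral _ _
  calc ∫⁻ x, ‖g x‖ₑ ^ m ∂μ ≤ ∫⁻ x, (∫⁻ y, S.indicator (fun z => F z.2) (x, y)) ∂μ :=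
        lintegral_mono key
    _ = ∫⁻ y, ∫⁻ x, S.indicator (fun z => F z.2) (x, y) ∂μ :=
        lintegral_lintegral_swap (f := fun x y => S.indicator (fun z => F z.2) (x, y))
          ((hF.comp measurable_snd).indicator hS).aemeasurable
    _ ≤ ∫⁻ y, (Ioo (0 : ℝ) 1).indicator (fun y => ENNReal.ofReal (8 * 2 ^ m * K) *
          ENNReal.ofReal a ^ (1 - α) * ‖g y‖ₑ ^ p) y := by
        refine lintegral_mono fun y => ?_
        by_cases hy : g y = 0
        · have : ∀ x, S.indicator (fun z => F z.2) (x, y) = 0 := fun x => by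
            refine indicator_of_notMem (fun hx => ?_) _
            have hx' : |x - y| < g y ^ 2 / a := hx
            rw [hy] at hx'
            have := abs_nonneg (x - y)
            simp at hx'
            linarith
          simp [this]
        have hey := he hy
        rw [indicator_of_mem (hsupp y hy)]
        have e1 : ∀ x, S.indicator (fun z => F z.2) (x, y) =
            (Metric.ball y (g y ^ 2 / a)).indicator (fun _ => F y) x := fun x => rfl
        simp only [e1]
        rw [lintegral_indicator_const Metric.isOpen_ball.measurableSet]
        -- At radius `g(y)²/a` the power of `|g y|` becomes `m - 2 + 2α = p`, and `a^(1-α)` remains.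
        calc F y * μ (Metric.ball y (g y ^ 2 / a))
            ≤ F y * ENNReal.ofReal (K * (g y ^ 2 / a) ^ α) := by
              gcongr; exact hμ y (hsupp y hy) _ hey
          _ = _ := by
              rw [hen y hp, ENNReal.ofReal_rpow_of_pos ha, ENNReal.ofReal_mul' (by positivity),
                ENNReal.ofReal_mul (q := K) (by positivity)]
              suffices hs : F y * ENNReal.ofReal ((g y ^ 2 / a) ^ α) = ENNReal.ofReal (8 * 2 ^ m) *
                  ENNReal.ofReal (a ^ (1 - α)) * ENNReal.ofReal (|g y| ^ p) by
                rw [mul_left_comm, hs]; ring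
              simp only [F]
              rw [← ENNReal.ofReal_mul (by positivity), ← ENNReal.ofReal_mul (by positivity),
                ← ENNReal.ofReal_mul (by positivity)]
              congr 1
              have hga : 0 < |g y| := abs_pos.2 hy
              rw [← sq_abs, Real.div_rpow (by positivity) ha.le, ← Real.rpow_natCast |g y| 2,
                ← Real.rpow_mul hga.le, Real.rpow_sub ha, Real.rpow_one]
              have : |g y| ^ m = |g y| ^ p * |g y| ^ (((2 : ℕ) : ℝ)) / |g y| ^ (((2 : ℕ) : ℝ) * α) := by
                rw [← Real.rpow_add hga, ← Real.rpow_sub hga]; congr 1; rw [hm]; push_cast; ring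
              rw [this]
              field_simp
    _ = _ := by
        rw [lintegral_indicator measurableSet_Ioo, lintegral_const_mul' _ _ ]
        exact ENNReal.mul_ne_top ENNReal.ofReal_ne_top
          (ENNReal.rpow_ne_top_of_nonneg (by linarith) ENNReal.ofReal_ne_top)

/-- Jensen's inequality for a concave power, obtained from Hölder's inequality against the constant
`1`. -/
theorem lintegral_rpow_le_rpow_lintegral {X : Type*} [MeasurableSpace X] {ν : Measure X}
    (hν : ν univ ≤ 1) {g : X → ℝ≥0∞} (hg : AEMeasurable g ν) {c : ℝ} (hc0 : 0 ≤ c) (hc1 : c ≤ 1) :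
    ∫⁻ x, g x ^ c ∂ν ≤ (∫⁻ x, g x ∂ν) ^ c := by
  have h := ENNReal.lintegral_mul_norm_pow_le (μ := ν) hg (aemeasurable_const (b := (1 : ℝ≥0∞)))
    hc0 (sub_nonneg.2 hc1) (add_sub_cancel c 1)
  simp only [ENNReal.one_rpow, mul_one, lintegral_one] at h
  exact h.trans (mul_le_of_le_one_right' (ENNReal.rpow_le_one hν (sub_nonneg.2 hc1)))

/-- Cauchy–Schwarz. Only a pointwise inequality is asked of the integrand, so that the bound `1 ≤ w
* k` can be used in the same step. -/
theorem lintegral_mul_le_sqrt_mul_sqrt {X : Type*} [MeasurableSpace X] {ν : Measure X}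
    {g u v : X → ℝ≥0∞} (hu : AEMeasurable u ν) (hv : AEMeasurable v ν)
    (h : ∀ x, g x ≤ (u x * v x) ^ (1 / 2 : ℝ)) :
    ∫⁻ x, g x ∂ν ≤ (∫⁻ x, u x ∂ν) ^ (1 / 2 : ℝ) * (∫⁻ x, v x ∂ν) ^ (1 / 2 : ℝ) := by
  refine (lintegral_mono fun x => ?_).trans (ENNReal.lintegral_mul_norm_pow_le hu hv
    (by norm_num) (by norm_num) (by norm_num))
  rw [← ENNReal.mul_rpow_of_nonneg _ _ (by norm_num)]
  exact h x

/-- The trace inequality `lintegral_rpow_le_of_growth` for compactly supported `C¹` functions. -/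
theorem lintegral_weight_mul_rpow_le_of_deriv {g : ℝ → ℝ} (hg : ContDiff ℝ 1 g)
    (hgc : HasCompactSupport g) (hgs : ∀ x, g x ≠ 0 → x ∈ Ioo (0 : ℝ) 1) {w : ℝ → ℝ≥0∞}
    (hw : Measurable w) {K α q : ℝ} (hα0 : 0 ≤ α) (hα : α < 1) (hq : 0 < q)
    (hμ : ∀ y ∈ Ioo (0 : ℝ) 1, ∀ δ > 0,
      ∫⁻ x in Metric.ball y δ, w x ≤ ENNReal.ofReal (K * δ ^ α)) :
    ∫⁻ x, w x * ‖g x‖ₑ ^ (α * q + 2 * (1 - α)) ≤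
      ENNReal.ofReal (8 * 2 ^ (α * q + 2 * (1 - α)) * K) *
        ((∫⁻ x, ‖deriv g x‖ₑ ^ 2) ^ (1 - α) * (∫⁻ x, ‖g x‖ₑ ^ q) ^ α) := by
  have hα1 : 0 < 1 - α := by linarith
  have hm0 : 0 < α * q + 2 * (1 - α) := by positivity
  have hp0 : 0 ≤ α * q := by positivity
  have hgcont := hg.continuous
  have hol := enorm_sub_sq_le_lintegral_deriv hg
  set a := ∫⁻ x, ‖deriv g x‖ₑ ^ 2 with ha
  have hafin : a ≠ ⊤ := by
    have hcont : Continuous (deriv g) := hg.continuous_deriv le_rfl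
    have hsq : HasCompactSupport (fun x => deriv g x ^ 2) :=
      hgc.deriv.mono fun x hx h => hx (by simp [h])
    have h2 : Integrable (fun x => deriv g x ^ 2) :=
      (hcont.pow 2).integrable_of_hasCompactSupport hsq
    have := h2.2.ne
    simpa only [enorm_pow] using this
  -- The scale `g²/a` needs `a > 0`. If `a = 0`, then `g` is constant, and it vanishes at `2`.
  rcases eq_or_ne a 0 with h0 | h0
  · have hz : ∀ x, g x = 0 := fun x => by
      have h2 : g 2 = 0 := by
        by_contra h; exact absurd (hgs 2 h).2 (by norm_num)
      have := hol x 2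
      rw [h0, mul_zero, h2, sub_zero] at this
      simpa using this
    simp [hz, hm0]
  have hat : 0 < a.toReal := ENNReal.toReal_pos h0 hafin
  have hol' : ∀ x z, (g x - g z) ^ 2 ≤ a.toReal * |x - z| := fun x z => by
    have := hol x z
    rw [← ENNReal.ofReal_toReal hafin, ← ENNReal.ofReal_mul (abs_nonneg _),
      ← enorm_pow, Real.enorm_of_nonneg (sq_nonneg _),
      ENNReal.ofReal_le_ofReal_iff (by positivity)] at this
    linarith
  have hμ' : ∀ z ∈ Ioo (0 : ℝ) 1, ∀ δ > 0,
      volume.withDensity w (Metric.ball z δ) ≤ ENNReal.ofReal (K * δ ^ α) := fun z hz δ hδ => by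
    rw [withDensity_apply _ Metric.isOpen_ball.measurableSet]
    exact hμ z hz δ hδ
  have h1 := lintegral_rpow_le_of_growth hgcont hgs hat hol' hα hp0 hμ'
  rw [lintegral_withDensity_eq_lintegral_mul _ hw (hgcont.enorm.measurable.pow_const _),
    ENNReal.ofReal_toReal hafin, mul_assoc] at h1
  refine h1.trans ?_
  gcongr
  -- The trace inequality was applied with `p = αq`, so Jensen on `(0,1)` gives `(∫ |g|^q)^α`.
  refine le_trans (le_of_eq ?_) ((lintegral_rpow_le_rpow_lintegral (c := α)
    (ν := volume.restrict (Ioo 0 1)) (g := fun x => ‖g x‖ₑ ^ q) (by simp)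
    (hgcont.enorm.measurable.pow_const _).aemeasurable hα0 hα.le).trans ?_)
  · refine lintegral_congr fun x => ?_
    rw [← ENNReal.rpow_mul, mul_comm]
  · gcongr
    exact Measure.restrict_le_self

/-! ### Gagliardo, trace and Sobolev inequalities in two variables -/

section Plane

variable {f : ℝ × ℝ → ℝ}

theorem deriv_slice_fst (hf : ContDiff ℝ 1 f) (x y : ℝ) :
    deriv (fun x => f (x, y)) x = fderiv ℝ f (x, y) (1, 0) := by
  have h := ((hf.differentiable one_ne_zero) (x, y)).hasFDerivAt.comp_hasDerivAt x
    ((hasDerivAt_id x).prodMk (hasDerivAt_const x y))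
  exact h.deriv

theorem deriv_slice_snd (hf : ContDiff ℝ 1 f) (x y : ℝ) :
    deriv (fun y => f (x, y)) y = fderiv ℝ f (x, y) (0, 1) := by
  have h := ((hf.differentiable one_ne_zero) (x, y)).hasFDerivAt.comp_hasDerivAt y
    ((hasDerivAt_const y x).prodMk (hasDerivAt_id y))
  exact h.deriv

theorem hasCompactSupport_slice_fst (hc : HasCompactSupport f) (y : ℝ) :
    HasCompactSupport (fun x => f (x, y)) := by
  refine HasCompactSupport.intro (hc.image continuous_fst) fun x hx => ?_
  by_contra h
  exact hx ⟨(x, y), subset_tsupport _ h, rfl⟩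

theorem hasCompactSupport_slice_snd (hc : HasCompactSupport f) (x : ℝ) :
    HasCompactSupport (fun y => f (x, y)) := by
  refine HasCompactSupport.intro (hc.image continuous_snd) fun y hy => ?_
  by_contra h
  exact hy ⟨(x, y), subset_tsupport _ h, rfl⟩

theorem continuous_fderiv_apply_const (hf : ContDiff ℝ 1 f) (v : ℝ × ℝ) :
    Continuous fun z => fderiv ℝ f z v :=
  (hf.continuous_fderiv one_ne_zero).clm_apply continuous_const

/-- The Gagliardo inequality in the plane. -/
theorem lintegral_rpow_le_mul_lintegral_fderiv (hf : ContDiff ℝ 1 f) (hc : HasCompactSupport f)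
    {s t : ℝ} (hs : 1 < s) (ht : 1 < t) :
    ∫⁻ z, ‖f z‖ₑ ^ (s + t) ≤
      (ENNReal.ofReal s * ∫⁻ z, ‖f z‖ₑ ^ (s - 1) * ‖fderiv ℝ f z (1, 0)‖ₑ) *
        (ENNReal.ofReal t * ∫⁻ z, ‖f z‖ₑ ^ (t - 1) * ‖fderiv ℝ f z (0, 1)‖ₑ) := by
  have hfc := hf.continuous
  have m1 : Measurable fun z => ‖f z‖ₑ ^ (s - 1) * ‖fderiv ℝ f z (1, 0)‖ₑ := by
    have := continuous_fderiv_apply_const hf (1, 0)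
    exact (hfc.enorm.measurable.pow_const _).mul this.enorm.measurable
  have m2 : Measurable fun z => ‖f z‖ₑ ^ (t - 1) * ‖fderiv ℝ f z (0, 1)‖ₑ := by
    have := continuous_fderiv_apply_const hf (0, 1)
    exact (hfc.enorm.measurable.pow_const _).mul this.enorm.measurable
  have b1 : ∀ x y, ‖f (x, y)‖ₑ ^ s ≤
      ENNReal.ofReal s * ∫⁻ x, ‖f (x, y)‖ₑ ^ (s - 1) * ‖fderiv ℝ f (x, y) (1, 0)‖ₑ := by
    intro x y
    have h := enorm_rpow_le_lintegral_deriv (g := fun x => f (x, y)) (by fun_prop)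
      (hasCompactSupport_slice_fst hc y) hs x
    simpa only [deriv_slice_fst hf] using h
  have b2 : ∀ x y, ‖f (x, y)‖ₑ ^ t ≤
      ENNReal.ofReal t * ∫⁻ y, ‖f (x, y)‖ₑ ^ (t - 1) * ‖fderiv ℝ f (x, y) (0, 1)‖ₑ := by
    intro x y
    have h := enorm_rpow_le_lintegral_deriv (g := fun y => f (x, y)) (by fun_prop)
      (hasCompactSupport_slice_snd hc x) ht y
    simpa only [deriv_slice_snd hf] using h
  -- The bound `b1` does not depend on `x`, nor `b2` on `y`, so the integral of their product
  -- factorises.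
  rw [Measure.volume_eq_prod, lintegral_prod_symm _ m1.aemeasurable,
    lintegral_prod _ m2.aemeasurable, ← lintegral_const_mul' _ _ ENNReal.ofReal_ne_top,
    ← lintegral_const_mul' _ _ ENNReal.ofReal_ne_top, mul_comm, ← lintegral_prod_mul]
  · refine lintegral_mono fun z => ?_
    rw [ENNReal.rpow_add_of_nonneg _ _ (by linarith) (by linarith), mul_comm]
    exact mul_le_mul' (b2 z.1 z.2) (b1 z.1 z.2)
  · exact (m2.lintegral_prod_right'.const_mul _).aemeasurable
  · exact (m1.lintegral_prod_left'.const_mul _).aemeasurable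

/-- The weighted trace inequality for functions of two variables, obtained by integrating
`lintegral_rpow_le_of_growth` over the horizontal slices. -/
theorem lintegral_weight_mul_rpow_le (hf : ContDiff ℝ 1 f) (hc : HasCompactSupport f)
    (hsupp : ∀ z, f z ≠ 0 → z ∈ Ioo (0 : ℝ) 1 ×ˢ Ioo (0 : ℝ) 1) {w : ℝ → ℝ≥0∞}
    (hw : Measurable w) {K α q : ℝ} (hα0 : 0 ≤ α) (hα : α < 1) (hq : 0 < q)
    (hμ : ∀ y ∈ Ioo (0 : ℝ) 1, ∀ δ > 0,
      ∫⁻ x in Metric.ball y δ, w x ≤ ENNReal.ofReal (K * δ ^ α)) :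
    ∫⁻ z, w z.1 * ‖f z‖ₑ ^ (α * q + 2 * (1 - α)) ≤
      ENNReal.ofReal (8 * 2 ^ (α * q + 2 * (1 - α)) * K) *
        ((∫⁻ z, ‖fderiv ℝ f z (1, 0)‖ₑ ^ 2) ^ (1 - α) * (∫⁻ z, ‖f z‖ₑ ^ q) ^ α) := by
  set m : ℝ := α * q + 2 * (1 - α) with hm
  have hα1 : 0 < 1 - α := by linarith
  have hm0 : 0 < m := by positivity
  have hfc := hf.continuous
  have md : Measurable fun z => ‖fderiv ℝ f z (1, 0)‖ₑ ^ 2 :=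
    (continuous_fderiv_apply_const hf (1, 0)).enorm.measurable.pow_const 2
  have mq : Measurable fun z => ‖f z‖ₑ ^ q := hfc.enorm.measurable.pow_const q
  have mw : Measurable fun z : ℝ × ℝ => w z.1 * ‖f z‖ₑ ^ m :=
    (hw.comp measurable_fst).mul (hfc.enorm.measurable.pow_const m)
  have slice : ∀ y, ∫⁻ x, w x * ‖f (x, y)‖ₑ ^ m ≤ ENNReal.ofReal (8 * 2 ^ m * K) *
      ((∫⁻ x, ‖fderiv ℝ f (x, y) (1, 0)‖ₑ ^ 2) ^ (1 - α) * (∫⁻ x, ‖f (x, y)‖ₑ ^ q) ^ α) := by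
    intro y
    simp only [← deriv_slice_fst hf]
    exact lintegral_weight_mul_rpow_le_of_deriv (g := fun x => f (x, y)) (by fun_prop)
      (hasCompactSupport_slice_fst hc y) (fun x hx => (hsupp (x, y) hx).1) hw hα0 hα hq hμ
  rw [Measure.volume_eq_prod, lintegral_prod_symm _ mw.aemeasurable,
    lintegral_prod_symm _ md.aemeasurable, lintegral_prod_symm _ mq.aemeasurable]
  refine (lintegral_mono slice).trans ?_
  rw [lintegral_const_mul' _ _ ENNReal.ofReal_ne_top]
  gcongr
  -- The exponents `1 - α` and `α` add up to one, so Hölder's inequality integrates the slice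
  -- bounds.
  exact ENNReal.lintegral_mul_norm_pow_le md.lintegral_prod_left'.aemeasurable
    mq.lintegral_prod_left'.aemeasurable hα1.le hα0 (by ring)

/-- The weighted Sobolev inequality for `C¹` functions with compact support in the unit square. -/
theorem exists_sobolev_inequality {w k : ℝ → ℝ≥0∞} (hw : Measurable w) (hk : Measurable k)
    (hwk : ∀ x ∈ Ioo (0 : ℝ) 1, 1 ≤ w x * k x) {K α : ℝ} (hα0 : 0 ≤ α) (hα : α < 1)
    (hμ : ∀ y ∈ Ioo (0 : ℝ) 1, ∀ δ > 0,
      ∫⁻ x in Metric.ball y δ, w x ≤ ENNReal.ofReal (K * δ ^ α)) :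
    ∃ C : ℝ≥0∞, C ≠ ⊤ ∧ ∀ f : ℝ × ℝ → ℝ, ContDiff ℝ 1 f → HasCompactSupport f →
      (∀ z, f z ≠ 0 → z ∈ Ioo (0 : ℝ) 1 ×ˢ Ioo (0 : ℝ) 1) →
      (∫⁻ z, ‖f z‖ₑ ^ (4 / (1 - α))) ^ (1 / (4 / (1 - α))) ≤
        C * (∫⁻ z, (‖fderiv ℝ f z (1, 0)‖ₑ ^ 2 + k z.1 * ‖fderiv ℝ f z (0, 1)‖ₑ ^ 2)) ^
          (1 / 2 : ℝ) := by
  have hα1 : 0 < 1 - α := by linarith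
  -- The exponent `m` is dictated by the trace inequality with `p = αq`, and `t` by `2(t - 1) = m`.
  -- The value of `q` makes `αq = q - 4`, so that `s = q - t` equals `q/2 + α`.
  set q : ℝ := 4 / (1 - α) with hq
  have hqα : α * q = q - 4 := by rw [hq]; field_simp; ring
  have hq4 : 4 ≤ q := by rw [hq, le_div_iff₀ hα1]; linarith
  set m : ℝ := α * q + 2 * (1 - α) with hm
  set s : ℝ := q / 2 + α with hs
  set t : ℝ := m / 2 + 1 with ht
  have hst : s + t = q := by linarith
  have hs1 : 1 < s := by linarith
  have ht1 : 1 < t := by nlinarith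
  set C₀ : ℝ≥0∞ := ENNReal.ofReal s * ENNReal.ofReal t *
    ENNReal.ofReal (8 * 2 ^ m * K) ^ (1 / 2 : ℝ) with hC₀
  have hC₀t : C₀ ≠ ⊤ := ENNReal.mul_ne_top (ENNReal.mul_ne_top ENNReal.ofReal_ne_top
    ENNReal.ofReal_ne_top) (ENNReal.rpow_ne_top_of_nonneg (by norm_num) ENNReal.ofReal_ne_top)
  refine ⟨C₀ ^ (1 / (3 - α)), ENNReal.rpow_ne_top_of_nonneg
    (one_div_nonneg.2 (by linarith)) hC₀t, fun f hf hc hsupp => ?_⟩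
  have hfc := hf.continuous
  have c1 := continuous_fderiv_apply_const hf (1, 0)
  have c2 := continuous_fderiv_apply_const hf (0, 1)
  have mk2 : Measurable fun z : ℝ × ℝ => k z.1 * ‖fderiv ℝ f z (0, 1)‖ₑ ^ 2 :=
    (hk.comp measurable_fst).mul (c2.enorm.measurable.pow_const 2)
  have mwm : Measurable fun z : ℝ × ℝ => w z.1 * ‖f z‖ₑ ^ m :=
    (hw.comp measurable_fst).mul (hfc.enorm.measurable.pow_const m)
  have hoff : ∀ z, z ∉ Ioo (0 : ℝ) 1 ×ˢ Ioo (0 : ℝ) 1 → f z = 0 := fun z hz => by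
    by_contra h; exact hz (hsupp z h)
  have hpow : ∀ x : ℝ≥0∞, (x ^ 2) ^ (1 / 2 : ℝ) = x := fun x => by
    rw [← ENNReal.rpow_natCast, ← ENNReal.rpow_mul]; norm_num
  set N := ∫⁻ z, ‖f z‖ₑ ^ q with hN
  set E := ∫⁻ z, (‖fderiv ℝ f z (1, 0)‖ₑ ^ 2 + k z.1 * ‖fderiv ℝ f z (0, 1)‖ₑ ^ 2) with hE
  have hE1 : ∫⁻ z, ‖fderiv ℝ f z (1, 0)‖ₑ ^ 2 ≤ E := lintegral_mono fun z => le_self_add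
  have hE2 : ∫⁻ z, k z.1 * ‖fderiv ℝ f z (0, 1)‖ₑ ^ 2 ≤ E := lintegral_mono fun z => le_add_self
  have hNt : N ≠ ⊤ := by
    have hi : Integrable (fun z => ‖f z‖ ^ q) := by
      refine (Continuous.rpow_const (by fun_prop) fun _ =>
        Or.inr (by linarith)).integrable_of_hasCompactSupport (hc.comp_left
          (g := fun t : ℝ => ‖t‖ ^ q) ?_)
      simp only [norm_zero]
      exact Real.zero_rpow (by linarith)
    have := hi.2.ne
    refine ne_of_eq_of_ne (lintegral_congr fun z => ?_) this
    rw [Real.enorm_rpow_of_nonneg (norm_nonneg _) (by linarith), enorm_norm]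
  -- Cauchy–Schwarz, then Jensen on the unit square, since `2(s - 1) = q - 2(1 - α) ≤ q`.
  have hfirst : ∫⁻ z, ‖f z‖ₑ ^ (s - 1) * ‖fderiv ℝ f z (1, 0)‖ₑ ≤
      (N ^ (2 * (s - 1) / q)) ^ (1 / 2 : ℝ) * E ^ (1 / 2 : ℝ) := by
    have hj := lintegral_rpow_le_rpow_lintegral (c := 2 * (s - 1) / q)
      (ν := volume.restrict (Ioo (0 : ℝ) 1 ×ˢ Ioo (0 : ℝ) 1)) (g := fun z => ‖f z‖ₑ ^ q)
      (by simp [Measure.volume_eq_prod]) (by fun_prop) (div_nonneg (by linarith) (by linarith))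
      ((div_le_one (by linarith)).2 (by linarith))
    have hj2 : ∫⁻ z, ‖f z‖ₑ ^ (2 * (s - 1)) ≤ N ^ (2 * (s - 1) / q) := by
      rw [← setLIntegral_eq_of_support_subset
        (s := Ioo (0 : ℝ) 1 ×ˢ Ioo (0 : ℝ) 1)]
      · refine le_trans (le_of_eq (lintegral_congr fun z => ?_)) (hj.trans ?_)
        · rw [← ENNReal.rpow_mul]; congr 1; field_simp
        · gcongr
          exact setLIntegral_le_lintegral _ _
      · intro z hz
        by_contra h
        rw [Function.mem_support, hoff z h, enorm_zero,
          ENNReal.zero_rpow_of_pos (by linarith)] at hz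
        exact hz rfl
    refine (lintegral_mul_le_sqrt_mul_sqrt (u := fun z => ‖f z‖ₑ ^ (2 * (s - 1)))
      (v := fun z => ‖fderiv ℝ f z (1, 0)‖ₑ ^ 2) (by fun_prop)
      (c1.enorm.measurable.pow_const 2).aemeasurable fun z => ?_).trans ?_
    · rw [ENNReal.mul_rpow_of_nonneg _ _ (by norm_num), hpow, ← ENNReal.rpow_mul]
      refine le_of_eq ?_
      congr 2
      ring
    · gcongr
  -- As `w k ≥ 1`, the integrand is at most the geometric mean of `w |f|^m` and `k |∂₂f|²`; the
  -- trace inequality bounds the integral of the former.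
  have hsecond : ∫⁻ z, ‖f z‖ₑ ^ (t - 1) * ‖fderiv ℝ f z (0, 1)‖ₑ ≤
      (ENNReal.ofReal (8 * 2 ^ m * K) * (E ^ (1 - α) * N ^ α)) ^ (1 / 2 : ℝ) *
        E ^ (1 / 2 : ℝ) := by
    refine (lintegral_mul_le_sqrt_mul_sqrt mwm.aemeasurable mk2.aemeasurable
      fun z => ?_).trans ?_
    · by_cases hz : z ∈ Ioo (0 : ℝ) 1 ×ˢ Ioo (0 : ℝ) 1
      · rw [show w z.1 * ‖f z‖ₑ ^ m * (k z.1 * ‖fderiv ℝ f z (0, 1)‖ₑ ^ 2) =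
          w z.1 * k z.1 * (‖f z‖ₑ ^ m * ‖fderiv ℝ f z (0, 1)‖ₑ ^ 2) by ring,
          ENNReal.mul_rpow_of_nonneg _ _ (by norm_num),
          ENNReal.mul_rpow_of_nonneg (‖f z‖ₑ ^ m) _ (by norm_num), hpow, ← ENNReal.rpow_mul,
          show t - 1 = m * (1 / 2) by rw [ht]; ring]
        exact le_mul_of_one_le_left' (ENNReal.one_le_rpow (hwk z.1 hz.1) (by norm_num))
      · simp [hoff z hz, ht1]
    · gcongr
      exact (lintegral_weight_mul_rpow_le hf hc hsupp hw hα0 hα (by linarith) hμ).trans (by gcongr)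
  have hgag := lintegral_rpow_le_mul_lintegral_fderiv hf hc hs1 ht1
  rw [hst] at hgag
  have hmain : N ≤ C₀ * E ^ ((3 - α) / 2) * N ^ (1 - (3 - α) / q) := by
    refine hgag.trans ((mul_le_mul' (mul_le_mul_right hfirst _)
      (mul_le_mul_right hsecond _)).trans (le_of_eq ?_))
    rw [ENNReal.mul_rpow_of_nonneg _ _ (by norm_num), ENNReal.mul_rpow_of_nonneg _ _ (by norm_num),
      ← ENNReal.rpow_mul, ← ENNReal.rpow_mul, ← ENNReal.rpow_mul,
      show (3 - α) / 2 = 1 / 2 + 1 / 2 + (1 - α) * (1 / 2) by ring,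
      show 1 - (3 - α) / q = 2 * (s - 1) / q * (1 / 2) + α * (1 / 2) by
        rw [hs]; field_simp; linarith,
      ENNReal.rpow_add_of_nonneg _ _ (by norm_num) (by linarith),
      ENNReal.rpow_add_of_nonneg _ _ (by norm_num) (by norm_num),
      ENNReal.rpow_add_of_nonneg _ _ (mul_nonneg (div_nonneg (by linarith) (by linarith))
        (by norm_num)) (by linarith)]
    ring
  -- `N` is finite by compact support, so its power on the right of `hmain` can be cancelled. The
  -- power `1/(3 - α)` then produces the exponents `1/q` and `1/2`.
  have hbound : N ^ ((3 - α) / q) ≤ C₀ * E ^ ((3 - α) / 2) := by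
    rcases eq_or_ne N 0 with h0 | h0
    · rw [h0, ENNReal.zero_rpow_of_pos (div_pos (by linarith) (by linarith))]
      exact zero_le
    have hne0 : N ^ (1 - (3 - α) / q) ≠ 0 := by
      simp [ENNReal.rpow_eq_zero_iff, h0, hNt]
    have hnet : N ^ (1 - (3 - α) / q) ≠ ⊤ := by
      simp [ENNReal.rpow_eq_top_iff, h0, hNt]
    refine (ENNReal.mul_le_mul_iff_left hne0 hnet).1 ?_
    rw [← ENNReal.rpow_add _ _ h0 hNt, add_sub_cancel, ENNReal.rpow_one]
    exact hmain
  have h3 : 0 < 3 - α := by linarith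
  have hfin := ENNReal.rpow_le_rpow hbound (one_div_nonneg.2 h3.le)
  rw [ENNReal.mul_rpow_of_nonneg _ _ (one_div_nonneg.2 h3.le), ← ENNReal.rpow_mul,
    ← ENNReal.rpow_mul] at hfin
  convert! hfin using 2
  · field_simp
  · congr 1; field_simp

end Plane

/-! ### Coordinates on the Euclidean plane -/

/-- The identification of `ℝ × ℝ` with the Euclidean plane. -/
noncomputable def planeEquiv : (ℝ × ℝ) ≃L[ℝ] Plane :=
  (ContinuousLinearEquiv.finTwoArrow ℝ ℝ).symm.trans (EuclideanSpace.equiv (Fin 2) ℝ).symm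

theorem planeEquiv_fst (z : ℝ × ℝ) : planeEquiv z 0 = z.1 := rfl

theorem planeEquiv_snd (z : ℝ × ℝ) : planeEquiv z 1 = z.2 := rfl

theorem planeEquiv_inl : planeEquiv (1, 0) = EuclideanSpace.single 0 1 := by
  ext i; fin_cases i <;> simp [planeEquiv]

theorem planeEquiv_inr : planeEquiv (0, 1) = EuclideanSpace.single 1 1 := by
  ext i; fin_cases i <;> simp [planeEquiv]

theorem measurePreserving_planeEquiv : MeasurePreserving planeEquiv :=
  (PiLp.volume_preserving_toLp (Fin 2)).comp ((volume_preserving_finTwoArrow ℝ).symm _)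

theorem lintegral_plane (F : Plane → ℝ≥0∞) : ∫⁻ x, F x = ∫⁻ z, F (planeEquiv z) :=
  (measurePreserving_planeEquiv.lintegral_comp_emb
    planeEquiv.toHomeomorph.measurableEmbedding F).symm

/-- Total mass one makes the `L^q`-norms on `Ω` nondecreasing in `q`, which gives a constant
independent of `q`. -/
instance isProbabilityMeasure_unitSquare :
    IsProbabilityMeasure ((volume : Measure Plane).restrict unitSquare) where
  measure_univ := by
    have h := measurePreserving_planeEquiv.measure_preimage
      (unitSquare.isOpen.measurableSet.nullMeasurableSet)
    have e : planeEquiv ⁻¹' (unitSquare : Set Plane) = Ioo (0 : ℝ) 1 ×ˢ Ioo (0 : ℝ) 1 := by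
      ext z
      show (0 < z.1 ∧ z.1 < 1 ∧ 0 < z.2 ∧ z.2 < 1) ↔ _
      simp [and_assoc]
    rw [Measure.restrict_apply_univ, ← h, e, Measure.volume_eq_prod, Measure.prod_prod]
    simp

/-! ### The weights and the growth condition -/

/-- The part in `(0,1)` of the inverse of the degenerate coefficient. -/
noncomputable def inverseWeight (h : ℝ → ℝ) : ℝ → ℝ≥0∞ :=
  (Ioo (0 : ℝ) 1).indicator fun x => ENNReal.ofReal (h x)⁻¹

/-- The part in `(0,1)` of the degenerate coefficient. -/
noncomputable def directWeight (h : ℝ → ℝ) : ℝ → ℝ≥0∞ :=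
  (Ioo (0 : ℝ) 1).indicator fun x => ENNReal.ofReal (h x)

theorem measurable_indicator_Ioo {f : ℝ → ℝ≥0∞} (hf : ContinuousOn f (Ioo 0 1)) :
    Measurable ((Ioo (0 : ℝ) 1).indicator f) := by
  classical
  rw [← piecewise_eq_indicator]
  exact hf.measurable_piecewise continuousOn_const measurableSet_Ioo

namespace IsDegenerateCoefficient

variable {h : ℝ → ℝ}

theorem continuousOn_Ioo (hh : IsDegenerateCoefficient h) : ContinuousOn h (Ioo 0 1) :=
  hh.contDiffOn.continuousOn.mono Ioo_subset_Ioc_self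

theorem measurable_inverseWeight (hh : IsDegenerateCoefficient h) :
    Measurable (inverseWeight h) :=
  measurable_indicator_Ioo (ENNReal.continuous_ofReal.comp_continuousOn
    (hh.continuousOn_Ioo.inv₀ fun x hx => (hh.pos x ⟨hx.1, hx.2.le⟩).ne'))

theorem measurable_directWeight (hh : IsDegenerateCoefficient h) :
    Measurable (directWeight h) :=
  measurable_indicator_Ioo (ENNReal.continuous_ofReal.comp_continuousOn hh.continuousOn_Ioo)

theorem one_le_inverseWeight_mul_directWeight (hh : IsDegenerateCoefficient h) :
    ∀ x ∈ Ioo (0 : ℝ) 1, 1 ≤ inverseWeight h x * directWeight h x := by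
  intro x hx
  have hp := hh.pos x ⟨hx.1, hx.2.le⟩
  rw [inverseWeight, directWeight, indicator_of_mem hx, indicator_of_mem hx,
    ← ENNReal.ofReal_mul (by positivity), inv_mul_cancel₀ hp.ne', ENNReal.ofReal_one]

end IsDegenerateCoefficient

/-- Makes every radius up to `1` admissible in the ball condition; two points on the diagonal
suffice. -/
theorem one_le_diam_unitSquare : 1 ≤ Metric.diam (unitSquare : Set Plane) := by
  have hbdd : Bornology.IsBounded (unitSquare : Set Plane) := by
    refine (Metric.isBounded_iff_subset_closedBall 0).2 ⟨2, fun x hx => ?_⟩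
    obtain ⟨h1, h2, h3, h4⟩ := hx
    rw [mem_closedBall_zero_iff, EuclideanSpace.norm_eq, Fin.sum_univ_two]
    refine Real.sqrt_le_iff.2 ⟨by norm_num, ?_⟩
    simp only [Real.norm_eq_abs, sq_abs]
    nlinarith
  have hmem : ∀ c : ℝ, 0 < c → c < 1 → planeEquiv (c, c) ∈ (unitSquare : Set Plane) :=
    fun c h0 h1 => ⟨h0, h1, h0, h1⟩
  refine le_trans ?_ (Metric.dist_le_diam_of_mem hbdd (hmem (1 / 10) (by norm_num) (by norm_num))
    (hmem (9 / 10) (by norm_num) (by norm_num)))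
  rw [EuclideanSpace.dist_eq, Fin.sum_univ_two]
  simp only [planeEquiv_fst, planeEquiv_snd, Real.dist_eq]
  rw [Real.le_sqrt' one_pos, sq_abs]
  norm_num

/-- The ball condition, tested on balls with centre on the line `x₂ = 1/2`. -/
theorem InverseBallBound.lintegral_ball_le {h : ℝ → ℝ} {θ C₀ : ℝ} (hθ : 0 < θ)
    (hw : Measurable (inverseWeight h))
    (hball : InverseBallBound h θ C₀) {y δ : ℝ} (hy : y ∈ Ioo (0 : ℝ) 1) (hδ : 0 < δ)
    (hδ2 : δ ≤ 1 / 2) :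
    ∫⁻ x in Metric.ball y δ, inverseWeight h x ≤
      ENNReal.ofReal (|C₀| * (4 * Real.pi) ^ θ / 2 * δ ^ (2 * θ - 1)) := by
  set c : Plane := planeEquiv (y, 1 / 2) with hc
  have hcΩ : c ∈ unitSquare := ⟨hy.1, hy.2, by rw [hc, planeEquiv_snd]; norm_num,
    by rw [hc, planeEquiv_snd]; norm_num⟩
  -- The disc of radius `2δ` contains the square `B(y,δ) × B(1/2,δ)`, whose second side lies in
  -- `(0,1)` because `δ ≤ 1/2`. That side contributes `2δ` on the left, against `δ^(2θ)` on the
  -- right; hence the exponent `2θ - 1`.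
  have hb := hball c hcΩ (2 * δ) (by linarith) (le_trans (by linarith) one_le_diam_unitSquare)
  have hvol : volume.real (Metric.ball c (2 * δ) ∩ (unitSquare : Set Plane)) ≤
      4 * Real.pi * δ ^ 2 := by
    refine ENNReal.toReal_le_of_le_ofReal (by positivity)
      ((measure_mono inter_subset_left).trans (le_of_eq ?_))
    rw [EuclideanSpace.volume_ball_fin_two, ← ENNReal.ofReal_pow (by positivity),
      ← ENNReal.ofReal_mul (by positivity)]
    congr 1; ring
  have hupper : C₀ * volume.real (Metric.ball c (2 * δ) ∩ (unitSquare : Set Plane)) ^ θ ≤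
      |C₀| * (4 * Real.pi) ^ θ * δ ^ (2 * θ) := by
    calc _ ≤ |C₀| * (4 * Real.pi * δ ^ 2) ^ θ := by
          gcongr
          exact le_abs_self _
      _ = _ := by
          rw [Real.mul_rpow (by positivity) (by positivity), ← Real.rpow_natCast δ 2,
            ← Real.rpow_mul hδ.le]
          push_cast; ring
  have hlower : (∫⁻ x in Metric.ball y δ, inverseWeight h x) * ENNReal.ofReal (2 * δ) ≤
      ∫⁻ z in Metric.ball c (2 * δ) ∩ unitSquare, ENNReal.ofReal (h (z 0))⁻¹ := by
    rw [← lintegral_indicator (Metric.isOpen_ball.inter unitSquare.isOpen).measurableSet,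
      lintegral_plane, ← Real.volume_ball (1 / 2) δ,
      ← lintegral_indicator Metric.isOpen_ball.measurableSet,
      ← lintegral_indicator_one Metric.isOpen_ball.measurableSet, ← lintegral_prod_mul
        (hw.indicator Metric.isOpen_ball.measurableSet).aemeasurable
        (measurable_one.indicator Metric.isOpen_ball.measurableSet).aemeasurable,
      Measure.volume_eq_prod]
    refine lintegral_mono fun z => ?_
    by_cases h1 : z.1 ∈ Metric.ball y δ; swap
    · simp [indicator_of_notMem h1]
    by_cases h2 : z.2 ∈ Metric.ball (1 / 2) δ; swap
    · simp only [indicator_of_notMem h2, mul_zero, zero_le]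
    by_cases h3 : z.1 ∈ Ioo (0 : ℝ) 1; swap
    · simp only [inverseWeight, indicator_of_mem h1, indicator_of_notMem h3, zero_mul, zero_le]
    have hz : planeEquiv z ∈ Metric.ball c (2 * δ) ∩ (unitSquare : Set Plane) := by
      rw [Metric.mem_ball, Real.dist_eq, abs_lt] at h1 h2
      refine ⟨?_, h3.1, h3.2, ?_, ?_⟩
      · rw [Metric.mem_ball, EuclideanSpace.dist_eq, Fin.sum_univ_two, hc]
        simp only [planeEquiv_fst, planeEquiv_snd, Real.dist_eq, sq_abs]
        rw [Real.sqrt_lt' (by linarith)]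
        nlinarith
      · rw [planeEquiv_snd]; linarith
      · rw [planeEquiv_snd]; linarith
    simp only [indicator_of_mem h1, indicator_of_mem h2, indicator_of_mem hz, inverseWeight,
      indicator_of_mem h3, Pi.one_apply, mul_one, planeEquiv_fst, le_refl]
  have hmul := hlower.trans (hb.trans (ENNReal.ofReal_le_ofReal hupper))
  have h2δ : ENNReal.ofReal (2 * δ) ≠ 0 := by simpa using hδ
  refine (ENNReal.mul_le_mul_iff_left h2δ ENNReal.ofReal_ne_top).1 (hmul.trans (le_of_eq ?_))
  rw [← ENNReal.ofReal_mul (by positivity), Real.rpow_sub hδ, Real.rpow_one]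
  congr 1; field_simp

/-- The ball condition implies a growth condition for the measure `h⁻¹ dx₁` on `(0,1)`. -/
theorem InverseBallBound.exists_growth {h : ℝ → ℝ} {θ C₀ : ℝ} (hθ : 0 < θ)
    (hw : Measurable (inverseWeight h))
    (hball : InverseBallBound h θ C₀) :
    ∃ K : ℝ, ∀ y ∈ Ioo (0 : ℝ) 1, ∀ δ > 0, ∫⁻ x in Metric.ball y δ, inverseWeight h x ≤
      ENNReal.ofReal (K * δ ^ max (2 * θ - 1) 0) := by
  set K₀ : ℝ := |C₀| * (4 * Real.pi) ^ θ / 2 with hK₀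
  have hK₀0 : 0 ≤ K₀ := by positivity
  -- The ball of centre and radius `1/2` is all of `(0,1)`, so the total mass is finite.
  have htotal : ∀ y δ : ℝ, ∫⁻ x in Metric.ball y δ, inverseWeight h x ≤
      ENNReal.ofReal (K₀ * (1 / 2) ^ (2 * θ - 1)) := fun y δ => by
    have h1 := hball.lintegral_ball_le hθ hw (y := 1 / 2) (δ := 1 / 2) (by norm_num) (by norm_num)
      le_rfl
    refine (setLIntegral_le_lintegral _ _).trans (le_trans (le_of_eq ?_) h1)
    refine (setLIntegral_eq_of_support_subset fun x hx => ?_).symm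
    have hx' := support_indicator_subset hx
    rw [Real.ball_eq_Ioo]
    norm_num
    exact hx'
  -- The factor `2` serves the case `2θ ≤ 1`, where `(1/2)^(2θ-1) ≤ 2` because `θ > 0`.
  refine ⟨2 * K₀, fun y hy δ hδ => ?_⟩
  rcases le_or_gt (2 * θ - 1) 0 with h0 | h0
  · rw [max_eq_right h0, Real.rpow_zero, mul_one]
    refine (htotal y δ).trans (ENNReal.ofReal_le_ofReal ?_)
    have : (1 / 2 : ℝ) ^ (2 * θ - 1) ≤ (1 / 2) ^ (-1 : ℝ) :=
      Real.rpow_le_rpow_of_exponent_ge (by norm_num) (by norm_num) (by linarith)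
    rw [Real.rpow_neg_one] at this
    norm_num at this
    nlinarith
  · rw [max_eq_left h0.le]
    have hpos : 0 ≤ K₀ * δ ^ (2 * θ - 1) := by positivity
    rcases le_or_gt δ (1 / 2) with h2 | h2
    · exact (hball.lintegral_ball_le hθ hw hy hδ h2).trans (ENNReal.ofReal_le_ofReal (by rw [← hK₀]; linarith))
    · refine (htotal y δ).trans (ENNReal.ofReal_le_ofReal ?_)
      have : (1 / 2 : ℝ) ^ (2 * θ - 1) ≤ δ ^ (2 * θ - 1) :=
        Real.rpow_le_rpow (by norm_num) h2.le h0.le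
      nlinarith

/-! ### Weak derivatives, test functions and the energy -/

theorem hasWeakPartial_weakPartial {i : Fin 2} {u : Plane → ℝ} (hu : ∃ g, HasWeakPartial i u g) :
    HasWeakPartial i u (weakPartial i u) := by
  rw [weakPartial, dif_pos hu]
  exact hu.choose_spec

theorem MeasureTheory.LocallyIntegrableOn.integrable_mul_of_hasCompactSupport {u ψ : Plane → ℝ}
    (hu : LocallyIntegrableOn u unitSquare) (hψ : Continuous ψ) (hc : HasCompactSupport ψ)
    (hs : tsupport ψ ⊆ unitSquare) : Integrable (fun x => u x * ψ x) := by
  have hK : IntegrableOn u (tsupport ψ) := hu.integrableOn_compact_subset hs hc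
  have := hK.mul_continuousOn hψ.continuousOn hc
  rwa [integrableOn_iff_integrable_of_support_subset] at this
  exact fun x hx => subset_tsupport ψ (right_ne_zero_of_mul hx)

namespace TestFunction

variable (φ : 𝓓(unitSquare, ℝ))

theorem contDiff_one : ContDiff ℝ 1 φ := φ.contDiff.of_le (by norm_cast)

theorem continuous_fderiv_apply (v : Plane) : Continuous fun x => fderiv ℝ φ x v :=
  (φ.contDiff_one.continuous_fderiv one_ne_zero).clm_apply continuous_const

theorem hasCompactSupport_fderiv_apply (v : Plane) :
    HasCompactSupport fun x => fderiv ℝ φ x v := φ.hasCompactSupport.fderiv_apply ℝ v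

theorem tsupport_fderiv_apply_subset' (v : Plane) :
    tsupport (fun x => fderiv ℝ φ x v) ⊆ unitSquare :=
  (tsupport_fderiv_apply_subset ℝ v).trans φ.tsupport_subset

theorem hasWeakPartial (i : Fin 2) :
    HasWeakPartial i φ fun x => fderiv ℝ φ x (EuclideanSpace.single i 1) := by
  have hc := φ.continuous_fderiv_apply (EuclideanSpace.single i 1)
  have hφ := φ.continuous
  refine ⟨(φ.continuous.locallyIntegrable).locallyIntegrableOn _,
    hc.locallyIntegrable.locallyIntegrableOn _, fun ψ => ?_⟩
  have hψ := ψ.continuous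
  have hc' := ψ.continuous_fderiv_apply (EuclideanSpace.single i 1)
  rw [setIntegral_eq_integral_of_forall_compl_eq_zero fun x hx => by
      rw [image_eq_zero_of_notMem_tsupport (fun h => hx (φ.tsupport_subset h)), zero_mul],
    setIntegral_eq_integral_of_forall_compl_eq_zero fun x hx => by
      rw [image_eq_zero_of_notMem_tsupport (fun h => hx (ψ.tsupport_subset h)), mul_zero]]
  exact integral_mul_fderiv_eq_neg_fderiv_mul_of_integrable
    ((hc.mul hψ).integrable_of_hasCompactSupport ψ.hasCompactSupport.mul_left)
    ((hφ.mul hc').integrable_of_hasCompactSupport φ.hasCompactSupport.mul_right)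
    ((hφ.mul hψ).integrable_of_hasCompactSupport ψ.hasCompactSupport.mul_left)
    (fun x _ => φ.contDiff_one.differentiable one_ne_zero x)
    (fun x _ => ψ.contDiff_one.differentiable one_ne_zero x)

end TestFunction

theorem HasWeakPartial.sub {i : Fin 2} {u v g g' : Plane → ℝ} (hu : HasWeakPartial i u g)
    (hv : HasWeakPartial i v g') : HasWeakPartial i (u - v) (g - g') := by
  refine ⟨hu.1.sub hv.1, hu.2.1.sub hv.2.1, fun φ => ?_⟩
  have int1 : ∀ f : Plane → ℝ, LocallyIntegrableOn f unitSquare →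
      IntegrableOn (fun x => f x * fderiv ℝ φ x (EuclideanSpace.single i 1)) unitSquare :=
    fun f hf => (hf.integrable_mul_of_hasCompactSupport (φ.continuous_fderiv_apply _)
      (φ.hasCompactSupport_fderiv_apply _) (φ.tsupport_fderiv_apply_subset' _)).integrableOn
  have int2 : ∀ f : Plane → ℝ, LocallyIntegrableOn f unitSquare →
      IntegrableOn (fun x => f x * φ x) unitSquare :=
    fun f hf => (hf.integrable_mul_of_hasCompactSupport φ.continuous
      φ.hasCompactSupport φ.tsupport_subset).integrableOn
  simp only [Pi.sub_apply, sub_mul]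
  rw [integral_sub (int1 u hu.1) (int1 v hv.1), integral_sub (int2 g hu.2.1) (int2 g' hv.2.1),
    hu.2.2 φ, hv.2.2 φ]
  ring

/-- By uniqueness, the choice made in `weakPartial` is immaterial up to a null set. -/
theorem HasWeakPartial.weakPartial_ae_eq {i : Fin 2} {u g : Plane → ℝ}
    (hu : HasWeakPartial i u g) :
    weakPartial i u =ᵐ[volume.restrict unitSquare] g := by
  have h := (hasWeakPartial_weakPartial ⟨g, hu⟩).ae_eq hu
  exact (ae_restrict_iff' unitSquare.isOpen.measurableSet).2 h

theorem weakPartial_sub_ae_eq {i : Fin 2} {u v : Plane → ℝ} (hu : ∃ g, HasWeakPartial i u g)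
    (hv : ∃ g, HasWeakPartial i v g) :
    weakPartial i (u - v) =ᵐ[volume.restrict unitSquare] weakPartial i u - weakPartial i v :=
  ((hasWeakPartial_weakPartial hu).sub (hasWeakPartial_weakPartial hv)).weakPartial_ae_eq

theorem MemH1.sub {h : ℝ → ℝ} {u v : Plane → ℝ} (hu : MemH1 h u) (hv : MemH1 h v) :
    MemH1 h (u - v) where
  memLp := hu.memLp.sub hv.memLp
  weak_fst := ⟨_, (hasWeakPartial_weakPartial hu.weak_fst).sub
    (hasWeakPartial_weakPartial hv.weak_fst)⟩
  weak_snd := ⟨_, (hasWeakPartial_weakPartial hu.weak_snd).sub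
    (hasWeakPartial_weakPartial hv.weak_snd)⟩
  memLp_fst := (memLp_congr_ae (weakPartial_sub_ae_eq hu.weak_fst hv.weak_fst)).2
    (hu.memLp_fst.sub hv.memLp_fst)
  memLp_snd := by
    refine (memLp_congr_ae ?_).2 (hu.memLp_snd.sub hv.memLp_snd)
    filter_upwards [weakPartial_sub_ae_eq hu.weak_snd hv.weak_snd] with x hx
    simp only [hx, Pi.sub_apply, mul_sub]

theorem IsDegenerateCoefficient.pos_of_mem_unitSquare {h : ℝ → ℝ} (hh : IsDegenerateCoefficient h)
    {x : Plane} (hx : x ∈ (unitSquare : Set Plane)) : 0 < h (x 0) := hh.pos _ ⟨hx.1, hx.2.1.le⟩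

theorem ae_restrict_mem_unitSquare :
    ∀ᵐ x ∂(volume : Measure Plane).restrict unitSquare, x ∈ (unitSquare : Set Plane) :=
  ae_restrict_mem unitSquare.isOpen.measurableSet

theorem TestFunction.memH1 {h : ℝ → ℝ} (hh : IsDegenerateCoefficient h)
    (φ : 𝓓(unitSquare, ℝ)) : MemH1 h φ where
  memLp := (φ.continuous.memLp_of_hasCompactSupport φ.hasCompactSupport).restrict _
  weak_fst := ⟨_, φ.hasWeakPartial 0⟩
  weak_snd := ⟨_, φ.hasWeakPartial 1⟩
  memLp_fst := (memLp_congr_ae (φ.hasWeakPartial 0).weakPartial_ae_eq).2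
    (((φ.continuous_fderiv_apply _).memLp_of_hasCompactSupport
      (φ.hasCompactSupport_fderiv_apply _)).restrict _)
  memLp_snd := by
    obtain ⟨M, hM⟩ := hh.bounded
    have hd := φ.continuous_fderiv_apply (EuclideanSpace.single 1 1)
    obtain ⟨D, hD⟩ := hd.bounded_above_of_compact_support (φ.hasCompactSupport_fderiv_apply _)
    have hc : ContinuousOn (fun x : Plane => √(h (x 0))) unitSquare :=
      Real.continuous_sqrt.comp_continuousOn (hh.continuousOn_Ioo.comp (by fun_prop)
        fun x hx => ⟨hx.1, hx.2.1⟩)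
    refine (memLp_congr_ae (g := fun x : Plane =>
      √(h (x 0)) * fderiv ℝ φ x (EuclideanSpace.single 1 1)) ?_).2 (MemLp.of_bound
        ((hc.mul hd.continuousOn).aestronglyMeasurable unitSquare.isOpen.measurableSet)
        (√M * D) ?_)
    · filter_upwards [(φ.hasWeakPartial 1).weakPartial_ae_eq] with x hx
      rw [hx]
    · filter_upwards [ae_restrict_mem_unitSquare] with x hx
      rw [norm_mul, Real.norm_of_nonneg (Real.sqrt_nonneg _)]
      gcongr
      · exact (le_abs_self _).trans (hM _ ⟨hx.1.le, hx.2.1.le⟩)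
      · exact hD x

section Energy

variable {h : ℝ → ℝ} {u v : Plane → ℝ}

theorem sqrt_mul_sq_ae_eq (hh : IsDegenerateCoefficient h) (g : Plane → ℝ) :
    (fun x => (√(h (x 0)) * g x) ^ 2) =ᵐ[volume.restrict unitSquare]
      fun x => h (x 0) * g x ^ 2 := by
  filter_upwards [ae_restrict_mem_unitSquare] with x hx
  rw [mul_pow, Real.sq_sqrt (hh.pos_of_mem_unitSquare hx).le]

theorem MemH1.integrable_mul_sq (hh : IsDegenerateCoefficient h) (hu : MemH1 h u) :
    Integrable (fun x => h (x 0) * weakPartial 1 u x ^ 2) (volume.restrict unitSquare) :=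
  hu.memLp_snd.integrable_sq.congr (sqrt_mul_sq_ae_eq hh _)

theorem MemH1.integrable_energy (hh : IsDegenerateCoefficient h) (hu : MemH1 h u) :
    Integrable (fun x => weakPartial 0 u x ^ 2 + h (x 0) * weakPartial 1 u x ^ 2)
      (volume.restrict unitSquare) :=
  hu.memLp_fst.integrable_sq.add (hu.integrable_mul_sq hh)

theorem energy_nonneg_ae (hh : IsDegenerateCoefficient h) (u : Plane → ℝ) :
    0 ≤ᵐ[volume.restrict unitSquare]
      fun x => weakPartial 0 u x ^ 2 + h (x 0) * weakPartial 1 u x ^ 2 := by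
  filter_upwards [ae_restrict_mem_unitSquare] with x hx
  have := hh.pos_of_mem_unitSquare hx
  simp only [Pi.zero_apply]
  positivity

theorem energySeminorm_nonneg (h : ℝ → ℝ) (u : Plane → ℝ) : 0 ≤ energySeminorm h u :=
  Real.sqrt_nonneg _

theorem normH1_nonneg (h : ℝ → ℝ) (u : Plane → ℝ) : 0 ≤ normH1 h u := Real.sqrt_nonneg _

theorem sq_energySeminorm (hh : IsDegenerateCoefficient h) (u : Plane → ℝ) :
    energySeminorm h u ^ 2 =
      ∫ x in unitSquare, (weakPartial 0 u x ^ 2 + h (x 0) * weakPartial 1 u x ^ 2) :=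
  Real.sq_sqrt (integral_nonneg_of_ae (energy_nonneg_ae hh u))

theorem MemH1.sq_normH1 (hh : IsDegenerateCoefficient h) (hu : MemH1 h u) :
    normH1 h u ^ 2 = (∫ x in unitSquare, u x ^ 2) + energySeminorm h u ^ 2 := by
  rw [sq_energySeminorm hh, integral_add hu.memLp_fst.integrable_sq (hu.integrable_mul_sq hh),
    ← integral_congr_ae (sqrt_mul_sq_ae_eq hh _), ← add_assoc, normH1, Real.sq_sqrt]
  have : ∀ f : Plane → ℝ, 0 ≤ ∫ x in unitSquare, f x ^ 2 := fun f =>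
    integral_nonneg fun x => sq_nonneg _
  exact add_nonneg (add_nonneg (this _) (this _)) (this fun x => √(h (x 0)) * weakPartial 1 u x)

theorem MemH1.energySeminorm_le_normH1 (hh : IsDegenerateCoefficient h) (hu : MemH1 h u) :
    energySeminorm h u ≤ normH1 h u := by
  refine (sq_le_sq₀ (energySeminorm_nonneg h u) (normH1_nonneg h u)).1 ?_
  rw [hu.sq_normH1 hh]
  exact le_add_of_nonneg_left (integral_nonneg fun x => sq_nonneg _)

theorem MemH1.eLpNorm_le_normH1 (hh : IsDegenerateCoefficient h) (hu : MemH1 h u) :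
    eLpNorm u 2 (volume.restrict unitSquare) ≤ ENNReal.ofReal (normH1 h u) := by
  rw [hu.memLp.eLpNorm_eq_integral_rpow_norm two_ne_zero ENNReal.ofNat_ne_top]
  refine ENNReal.ofReal_le_ofReal ?_
  simp only [ENNReal.toReal_ofNat, Real.rpow_two, Real.norm_eq_abs, sq_abs]
  rw [← one_div, ← Real.sqrt_eq_rpow]
  refine Real.sqrt_le_iff.2 ⟨Real.sqrt_nonneg _, ?_⟩
  rw [hu.sq_normH1 hh]
  exact le_add_of_nonneg_right (sq_nonneg _)

/-- Pointwise, `b² ≤ 2a² + 2(a - b)²` amounts to `(2a - b)² ≥ 0`. This replaces the triangle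
inequality and is the source of the factor `√2` in `MemH10.eLpNorm_le`. -/
theorem MemH1.sq_energySeminorm_le (hh : IsDegenerateCoefficient h) (hu : MemH1 h u)
    (hv : MemH1 h v) :
    energySeminorm h v ^ 2 ≤ 2 * energySeminorm h u ^ 2 + 2 * energySeminorm h (u - v) ^ 2 := by
  have huv := hu.sub hv
  rw [sq_energySeminorm hh, sq_energySeminorm hh, sq_energySeminorm hh, ← integral_const_mul,
    ← integral_const_mul, ← integral_add ((hu.integrable_energy hh).const_mul 2)
      ((huv.integrable_energy hh).const_mul 2)]
  refine integral_mono_of_nonneg (energy_nonneg_ae hh v)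
    (((hu.integrable_energy hh).const_mul 2).add ((huv.integrable_energy hh).const_mul 2)) ?_
  filter_upwards [ae_restrict_mem_unitSquare, weakPartial_sub_ae_eq hu.weak_fst hv.weak_fst,
    weakPartial_sub_ae_eq hu.weak_snd hv.weak_snd] with x hx h0 h1
  have hp := hh.pos_of_mem_unitSquare hx
  simp only [h0, h1, Pi.sub_apply]
  have e0 := sq_nonneg (2 * weakPartial 0 u x - weakPartial 0 v x)
  have e1 := mul_nonneg hp.le (sq_nonneg (2 * weakPartial 1 u x - weakPartial 1 v x))
  nlinarith

end Energy

/-! ### From test functions to the closure -/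

/-- The Sobolev inequality for test functions. -/
theorem exists_eLpNorm_testFunction_le {h : ℝ → ℝ} (hh : IsDegenerateCoefficient h) {K α : ℝ}
    (hα0 : 0 ≤ α) (hα : α < 1) (hμ : ∀ y ∈ Ioo (0 : ℝ) 1, ∀ δ > 0,
      ∫⁻ x in Metric.ball y δ, inverseWeight h x ≤ ENNReal.ofReal (K * δ ^ α)) :
    ∃ C : ℝ, 0 < C ∧ ∀ φ : 𝓓(unitSquare, ℝ),
      eLpNorm φ (ENNReal.ofReal (4 / (1 - α))) (volume.restrict unitSquare) ≤
        ENNReal.ofReal (C * energySeminorm h φ) := by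
  obtain ⟨C, hCt, hC⟩ := exists_sobolev_inequality hh.measurable_inverseWeight
    hh.measurable_directWeight hh.one_le_inverseWeight_mul_directWeight hα0 hα hμ
  refine ⟨C.toReal + 1, by positivity, fun φ => ?_⟩
  set f : ℝ × ℝ → ℝ := fun z => φ (planeEquiv z) with hf
  have hf1 : ContDiff ℝ 1 f := φ.contDiff_one.comp planeEquiv.contDiff
  have hfc : HasCompactSupport f :=
    φ.hasCompactSupport.comp_homeomorph planeEquiv.toHomeomorph
  have hfs : ∀ z, f z ≠ 0 → z ∈ Ioo (0 : ℝ) 1 ×ˢ Ioo (0 : ℝ) 1 := fun z hz => by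
    obtain ⟨h1, h2, h3, h4⟩ := φ.tsupport_subset (subset_tsupport _ hz)
    exact ⟨⟨h1, h2⟩, h3, h4⟩
  have hfd : ∀ z v, fderiv ℝ f z v = fderiv ℝ φ (planeEquiv z) (planeEquiv v) := fun z v => by
    have := (φ.contDiff_one.differentiable one_ne_zero (planeEquiv z)).hasFDerivAt.comp z
      planeEquiv.hasFDerivAt
    exact congrArg (fun L => L v) this.fderiv
  have key := hC f hf1 hfc hfs
  have hq : 0 < 4 / (1 - α) := div_pos (by norm_num) (by linarith)
  have henergy : ∫⁻ z, (‖fderiv ℝ f z (1, 0)‖ₑ ^ 2 +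
      directWeight h z.1 * ‖fderiv ℝ f z (0, 1)‖ₑ ^ 2) =
      ENNReal.ofReal (energySeminorm h φ ^ 2) := by
    simp only [hfd, planeEquiv_inl, planeEquiv_inr, ← planeEquiv_fst]
    rw [← lintegral_plane fun x => ‖fderiv ℝ φ x (EuclideanSpace.single 0 1)‖ₑ ^ 2 +
        directWeight h (x 0) * ‖fderiv ℝ φ x (EuclideanSpace.single 1 1)‖ₑ ^ 2,
      sq_energySeminorm hh,
      ofReal_integral_eq_lintegral_ofReal ((φ.memH1 hh).integrable_energy hh)
        (energy_nonneg_ae hh _), ← setLIntegral_eq_of_support_subset (s := unitSquare)]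
    · refine lintegral_congr_ae ?_
      filter_upwards [ae_restrict_mem_unitSquare, (φ.hasWeakPartial 0).weakPartial_ae_eq,
        (φ.hasWeakPartial 1).weakPartial_ae_eq] with x hx h0 h1
      have hp := hh.pos_of_mem_unitSquare hx
      have hx0 : x 0 ∈ Ioo (0 : ℝ) 1 := ⟨hx.1, hx.2.1⟩
      rw [h0, h1, directWeight, indicator_of_mem hx0, ENNReal.ofReal_add (by positivity)
        (by positivity), ENNReal.ofReal_mul hp.le, ← enorm_pow, ← enorm_pow,
        Real.enorm_of_nonneg (sq_nonneg _), Real.enorm_of_nonneg (sq_nonneg _)]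
    · intro x hx
      by_contra hxΩ
      have hz : ∀ v, fderiv ℝ φ x v = 0 := fun v =>
        image_eq_zero_of_notMem_tsupport (f := fun x => fderiv ℝ φ x v)
          fun hmem => hxΩ (φ.tsupport_fderiv_apply_subset' v hmem)
      exact hx (by simp [hz])
  rw [henergy, ENNReal.ofReal_pow (energySeminorm_nonneg h φ), ← ENNReal.rpow_natCast,
    ← ENNReal.rpow_mul, show ((2 : ℕ) : ℝ) * (1 / 2) = 1 by norm_num, ENNReal.rpow_one] at key
  rw [eLpNorm_eq_lintegral_rpow_enorm_toReal (by simpa using hq) ENNReal.ofReal_ne_top,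
    ENNReal.toReal_ofReal hq.le, ENNReal.ofReal_mul (by positivity)]
  calc (∫⁻ x in unitSquare, ‖φ x‖ₑ ^ (4 / (1 - α))) ^ (1 / (4 / (1 - α)))
      ≤ (∫⁻ z, ‖f z‖ₑ ^ (4 / (1 - α))) ^ (1 / (4 / (1 - α))) := by
        rw [← lintegral_plane fun x => ‖φ x‖ₑ ^ (4 / (1 - α))]
        exact ENNReal.rpow_le_rpow (setLIntegral_le_lintegral _ _) (by positivity)
    _ ≤ _ := key
    _ ≤ _ := by
        gcongr
        rw [← ENNReal.ofReal_toReal hCt]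
        exact ENNReal.ofReal_le_ofReal (by simp)

/-- An inequality between an `L^q`-norm and the energy extends from test functions to
`ℋ¹_{h,0}(Ω)`, at the cost of a factor `√2`. -/
theorem MemH10.eLpNorm_le {h : ℝ → ℝ} (hh : IsDegenerateCoefficient h) {p : ℝ≥0∞} {C : ℝ}
    (hC0 : 0 < C) (hC : ∀ φ : 𝓓(unitSquare, ℝ),
      eLpNorm φ p (volume.restrict unitSquare) ≤ ENNReal.ofReal (C * energySeminorm h φ))
    {u : Plane → ℝ} (hu : MemH10 h u) :
    eLpNorm u p (volume.restrict unitSquare) ≤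
      ENNReal.ofReal (√2 * C * energySeminorm h u) := by
  obtain ⟨hu1, hap⟩ := hu
  choose φ hφ using fun n : ℕ => hap (1 / ((n : ℝ) + 1)) (by positivity)
  have hbound : ∀ n, eLpNorm (φ n) p (volume.restrict unitSquare) ≤
      ENNReal.ofReal (C * √(2 * energySeminorm h u ^ 2 + 2 * normH1 h (u - φ n) ^ 2)) := by
    intro n
    have hm := (φ n).memH1 hh
    refine (hC (φ n)).trans (ENNReal.ofReal_le_ofReal ?_)
    gcongr
    refine Real.le_sqrt_of_sq_le ((hu1.sq_energySeminorm_le hh hm).trans ?_)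
    have := pow_le_pow_left₀ (energySeminorm_nonneg h (u - φ n))
      ((hu1.sub hm).energySeminorm_le_normH1 hh) 2
    linarith
  have hnorm : Filter.Tendsto (fun n => normH1 h (u - φ n)) Filter.atTop (nhds 0) :=
    squeeze_zero (fun n => normH1_nonneg _ _) (fun n => (hφ n).le)
      tendsto_one_div_add_atTop_nhds_zero_nat
  -- It is not known beforehand that `u` lies in `L^p`. Convergence in `L²` yields an almost
  -- everywhere convergent subsequence, along which Fatou's lemma bounds the `L^p`-norm of the
  -- limit.
  have hmeas : TendstoInMeasure (volume.restrict unitSquare) (fun n => ⇑(φ n))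
      Filter.atTop u := by
    refine tendstoInMeasure_of_tendsto_eLpNorm (p := 2) two_ne_zero
      (fun n => ((φ n).memH1 hh).memLp.1) hu1.memLp.1 ?_
    have h0 : Filter.Tendsto (fun n => ENNReal.ofReal (normH1 h (u - φ n))) Filter.atTop
        (nhds 0) := by
      simpa only [ENNReal.ofReal_zero] using ENNReal.tendsto_ofReal hnorm
    refine tendsto_of_tendsto_of_tendsto_of_le_of_le tendsto_const_nhds h0 (fun _ => zero_le)
      fun n => ?_
    simp only
    rw [eLpNorm_sub_comm]
    exact (hu1.sub ((φ n).memH1 hh)).eLpNorm_le_normH1 hh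
  obtain ⟨ns, hns, hae⟩ := hmeas.exists_seq_tendsto_ae
  refine (Lp.eLpNorm_lim_le_liminf_eLpNorm (fun n => ((φ (ns n)).memH1 hh).memLp.1) u hae).trans ?_
  have hlim : Filter.Tendsto (fun n => ENNReal.ofReal (C * √(2 * energySeminorm h u ^ 2 +
      2 * normH1 h (u - φ (ns n)) ^ 2))) Filter.atTop
      (nhds (ENNReal.ofReal (√2 * C * energySeminorm h u))) := by
    have hcont : Continuous fun t : ℝ =>
        ENNReal.ofReal (C * √(2 * energySeminorm h u ^ 2 + 2 * t ^ 2)) :=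
      ENNReal.continuous_ofReal.comp (by fun_prop)
    have := (hcont.tendsto 0).comp (hnorm.comp hns.tendsto_atTop)
    have e : √2 * C * energySeminorm h u = C * √(2 * energySeminorm h u ^ 2 + 2 * 0 ^ 2) := by
      rw [zero_pow two_ne_zero, mul_zero, add_zero, Real.sqrt_mul zero_le_two,
        Real.sqrt_sq (energySeminorm_nonneg h u)]
      ring
    rw [e]
    exact this
  rw [← hlim.liminf_eq]
  exact Filter.liminf_le_liminf (Filter.Eventually.of_forall fun n => hbound (ns n))

theorem mainTheorem6 (h : ℝ → ℝ) (hh : IsDegenerateCoefficient h)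
    (θ : ℝ) (hθ0 : 0 < θ) (hθ1 : θ < 1) (hball : ∃ C₀ : ℝ, InverseBallBound h θ C₀) :
    (∃ C : ℝ, 0 < C ∧ ∀ q : ℝ, 2 ≤ q → q ≤ 2 / (1 - θ) → ∀ u : Plane → ℝ, MemH10 h u →
      eLpNorm u (ENNReal.ofReal q) (volume.restrict unitSquare) ≤
        ENNReal.ofReal (C * normH1 h u)) ∧
    (∃ C : ℝ, 0 < C ∧ ∀ u : Plane → ℝ, MemH10 h u →
      eLpNorm u 2 (volume.restrict unitSquare) ≤
        ENNReal.ofReal (C * energySeminorm h u)) := by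
  obtain ⟨C₀, hC₀⟩ := hball
  obtain ⟨K, hK⟩ := hC₀.exists_growth hθ0 hh.measurable_inverseWeight
  -- For `θ ≥ 1/2` the exponent `4/(1 - α)` is exactly `2/(1 - θ)`; for `θ < 1/2` it is `4`, which
  -- exceeds `2/(1 - θ)`.
  set α := max (2 * θ - 1) 0 with hα
  have hα0 : 0 ≤ α := le_max_right _ _
  have hα1 : α < 1 := max_lt (by linarith) one_pos
  obtain ⟨C, hC0, hC⟩ := exists_eLpNorm_testFunction_le hh hα0 hα1 hK
  have hmain : ∀ q : ℝ, 2 ≤ q → q ≤ 2 / (1 - θ) → ∀ u : Plane → ℝ, MemH10 h u →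
      eLpNorm u (ENNReal.ofReal q) (volume.restrict unitSquare) ≤
        ENNReal.ofReal (√2 * C * energySeminorm h u) := by
    intro q _ hq2 u hu
    have hqle : q ≤ 4 / (1 - α) := by
      refine hq2.trans ?_
      rw [div_le_div_iff₀ (by linarith) (by linarith)]
      linarith [le_max_left (2 * θ - 1) 0]
    exact (eLpNorm_le_eLpNorm_of_exponent_le (ENNReal.ofReal_le_ofReal hqle) hu.1.memLp.1).trans
      (hu.eLpNorm_le hh hC0 hC)
  refine ⟨⟨√2 * C, by positivity, fun q hq1 hq2 u hu => (hmain q hq1 hq2 u hu).trans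
    (ENNReal.ofReal_le_ofReal ?_)⟩, √2 * C, by positivity, fun u hu => ?_⟩
  · gcongr
    exact hu.1.energySeminorm_le_normH1 hh
  · have h2 : (2 : ℝ) ≤ 2 / (1 - θ) := by
      rw [le_div_iff₀ (by linarith)]; linarith
    simpa using hmain 2 le_rfl h2 u hu
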